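/- Let $X$ be a complex Banach space with open unit ball $B_X$ and bidual $X^{**}$; let $B_{X^{**}}$ and $S_{X^{**}}$ be the open unit ball and the unit sphere of $X^{**}$. Let $\mathcal H^\infty(B_X)$ be the algebra of bounded holomorphic functions $f\colon B_X\to\mathbb C$ with the supremum norm, $\mathcal A_u(B_X)$ its subalgebra of uniformly continuous functions, and let $\mathcal A$ be either $\mathcal A_u(B_X)$ or $\mathcal H^\infty(B_X)$. Let $\mathcal M(\mathcal A)$ be the set of nonzero algebra homomorphisms $\varphi\colon\mathcal A\to\mathbb C$. For $\varphi,\psi\in\mathcal M(\mathcal A)$ put $$\rho(\varphi,\psi)=\sup\{|\varphi(f)| : f\in\mathcal A,\ \|f\|\le 1,\ \psi(f)=0\},\qquad \mathcal{GP}(\varphi)=\{\psi\in\mathcal M(\mathcal A) : \rho(\varphi,\psi)<1\}$$ (the Gleason part of $\varphi$). For $z\in X^{**}$ with $\|z\|\le 1$, let $\mathcal M_z$ be the fiber over $z$, that is, the set of $\varphi\in\mathcal M(\mathcal A)$ with $\varphi(x^*|_{B_X})=z(x^*)$ for all $x^*\in X^*$. For $f\in\mathcal A$ with Taylor series $\sum_n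 P_n$ at $0$, where $P_n(x)=T_n(x,\dots,x)$ with $T_n$ a continuous symmetric $n$-linear form, let $\tilde f(z)=\sum_n \tilde T_n(z,\dots,z)$, $z\in B_{X^{**}}$, be its canonical (Aron–Berner) extension, where $$\tilde T_n(z_1,\dots,z_n)=\lim_{x_1\to z_1}\cdots\lim_{x_n\to z_n}T_n(x_1,\dots,x_n)$$ is the iterated weak-star limit over $x_i\in X$. (a) For every $z\in B_{X^{**}}$ the series defining $\tilde f(z)$ converges for each $f\in\mathcal A$, and $\delta_z(f)=\tilde f(z)$ defines an element $\delta_z$ of $\mathcal M(\mathcal A)$. The set $\{\delta_z : z\in B_{X^{**}}\}$ is contained in $\mathcal{GP}(\delta_0)$; in fact $\rho(\delta_0,\delta_z)=\|z\|$ for each $z\in B_{X^{**}}$. (b) Let $z\in S_{X^{**}}$ and $w\in B_{X^{**}}$. Then for any $\varphi\in\mathcal M_z$ and $\psi\in\mathcal M_w$ we have $\rho(\varphi,\psi)=1$; that is, $\varphi$ and $\psi$ lie in different Gleason parts: $\mathcal{GP}(\varphi)\neq\mathcal{GP}(\psi)$. -/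

import Mathlib

open scoped BoundedContinuousFunction

noncomputable section

namespace BallAlgebra

/-- The bidual `X**`, with its norm. -/
abbrev Bidual (X : Type*) [NormedAddCommGroup X] [NormedSpace ℂ X] : Type _ :=
  StrongDual ℂ (StrongDual ℂ X)

/-- The open unit ball `B_X`, as a type. -/
abbrev UnitBall (X : Type*) [NormedAddCommGroup X] : Type _ :=
  Metric.ball (0 : X) 1

/-- A function on `B_X`, regarded as a function on `X` (with value `0` off the ball), so that
one can speak of its analyticity and its derivatives at points of the open ball. -/
def ext0 {X : Type*} [NormedAddCommGroup X] (f : UnitBall X → ℂ) : X → ℂ :=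
  Function.extend Subtype.val f 0

theorem ext0_apply {X : Type*} [NormedAddCommGroup X] (f : UnitBall X → ℂ) (x : UnitBall X) :
    ext0 f x = f x :=
  Subtype.val_injective.extend_apply f 0 x

/-- `f : B_X → ℂ` is holomorphic, that is, complex-analytic at every point of `B_X`. -/
def IsHolo {X : Type*} [NormedAddCommGroup X] [NormedSpace ℂ X] (f : UnitBall X → ℂ) : Prop :=
  AnalyticOnNhd ℂ (ext0 f) (Metric.ball (0 : X) 1)

theorem isHolo_of_eq {X : Type*} [NormedAddCommGroup X] [NormedSpace ℂ X]
    {f : UnitBall X → ℂ} {g : X → ℂ} (hg : AnalyticOnNhd ℂ g (Metric.ball (0 : X) 1))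
    (h : ∀ x : UnitBall X, f x = g x) : IsHolo f := by
  refine AnalyticOnNhd.congr Metric.isOpen_ball hg ?_
  intro x hx
  exact ((ext0_apply f ⟨x, hx⟩).trans (h ⟨x, hx⟩)).symm

/-- `H^∞(B_X)`: the bounded holomorphic functions on `B_X`, with the supremum norm. -/
def Hinf (X : Type*) [NormedAddCommGroup X] [NormedSpace ℂ X] :
    Subalgebra ℂ (UnitBall X →ᵇ ℂ) where
  carrier := {f | IsHolo f}
  mul_mem' {f g} hf hg := isHolo_of_eq (AnalyticOnNhd.mul hf hg) fun x => by
    simp [ext0_apply]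
  add_mem' {f g} hf hg := isHolo_of_eq (AnalyticOnNhd.add hf hg) fun x => by
    simp [ext0_apply]
  algebraMap_mem' c := isHolo_of_eq (analyticOnNhd_const (v := c)) fun x => by
    simp [BoundedContinuousFunction.algebraMap_apply]

theorem uniformContinuous_mul {X : Type*} [NormedAddCommGroup X] {f g : UnitBall X →ᵇ ℂ}
    (hf : UniformContinuous f) (hg : UniformContinuous g) : UniformContinuous (f * g) := by
  rw [Metric.uniformContinuous_iff] at hf hg ⊢
  intro ε hε
  have hM : 0 < ‖f‖ + ‖g‖ + 1 := by positivity
  obtain ⟨d₁, hd₁, h₁⟩ := hf (ε / (2 * (‖f‖ + ‖g‖ + 1))) (by positivity)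
  obtain ⟨d₂, hd₂, h₂⟩ := hg (ε / (2 * (‖f‖ + ‖g‖ + 1))) (by positivity)
  refine ⟨min d₁ d₂, lt_min hd₁ hd₂, fun {a b} hab => ?_⟩
  have e₁ := h₁ (hab.trans_le (min_le_left _ _))
  have e₂ := h₂ (hab.trans_le (min_le_right _ _))
  rw [dist_eq_norm] at e₁ e₂ ⊢
  have key : (f * g) a - (f * g) b = f a * (g a - g b) + (f a - f b) * g b := by
    simp only [BoundedContinuousFunction.coe_mul, Pi.mul_apply]; ring
  rw [key]
  have n₁ : ‖f a * (g a - g b)‖ ≤ (‖f‖ + ‖g‖ + 1) * ‖g a - g b‖ := by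
    rw [norm_mul]
    gcongr
    linarith [f.norm_coe_le_norm a, norm_nonneg g]
  have n₂ : ‖(f a - f b) * g b‖ ≤ ‖f a - f b‖ * (‖f‖ + ‖g‖ + 1) := by
    rw [norm_mul]
    gcongr
    linarith [g.norm_coe_le_norm b, norm_nonneg f]
  rw [lt_div_iff₀ (by positivity)] at e₁ e₂
  calc _ ≤ _ := norm_add_le _ _
    _ ≤ _ := add_le_add n₁ n₂
    _ < ε := by linarith

/-- `A_u(B_X)`: the uniformly continuous holomorphic functions on `B_X`, with the supremum norm.
(A uniformly continuous function on `B_X` is automatically bounded.) -/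
def Au (X : Type*) [NormedAddCommGroup X] [NormedSpace ℂ X] :
    Subalgebra ℂ (UnitBall X →ᵇ ℂ) where
  carrier := {f | IsHolo f ∧ UniformContinuous f}
  mul_mem' hf hg := ⟨(Hinf X).mul_mem hf.1 hg.1, uniformContinuous_mul hf.2 hg.2⟩
  add_mem' hf hg := ⟨(Hinf X).add_mem hf.1 hg.1, hf.2.add hg.2⟩
  algebraMap_mem' c := ⟨(Hinf X).algebraMap_mem c, uniformContinuous_const⟩

/-- The restriction to `B_X` of a functional in `X*`. -/
def restrictDual {X : Type*} [NormedAddCommGroup X] [NormedSpace ℂ X] (L : StrongDual ℂ X) :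
    UnitBall X →ᵇ ℂ :=
  BoundedContinuousFunction.ofNormedAddCommGroup (fun x : UnitBall X => L x)
    (L.continuous.comp continuous_subtype_val) ‖L‖ fun x => by
      have hx : ‖(x : X)‖ < 1 := mem_ball_zero_iff.mp x.2
      exact (L.le_opNorm x).trans (mul_le_of_le_one_right (norm_nonneg L) hx.le)

/-- `X* ⊂ A` for both algebras. -/
theorem restrictDual_mem {X : Type*} [NormedAddCommGroup X] [NormedSpace ℂ X]
    {A : Subalgebra ℂ (UnitBall X →ᵇ ℂ)} (hA : A = Au X ∨ A = Hinf X) (L : StrongDual ℂ X) :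
    restrictDual L ∈ A := by
  have h : IsHolo (restrictDual L) := isHolo_of_eq (L.analyticOnNhd _) fun x => rfl
  rcases hA with rfl | rfl
  · exact ⟨h, L.uniformContinuous.comp uniformContinuous_subtype_val⟩
  · exact h

/-- The pseudo-hyperbolic distance on the spectrum `M(A)`, the set of nonzero (equivalently,
unital) homomorphisms `A → ℂ`. -/
def rho {X : Type*} [NormedAddCommGroup X] {A : Subalgebra ℂ (UnitBall X →ᵇ ℂ)}
    (φ ψ : A →ₐ[ℂ] ℂ) : ℝ :=
  sSup {r : ℝ | ∃ f : A, ‖f‖ ≤ 1 ∧ ψ f = 0 ∧ r = ‖φ f‖}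

/-- The Gleason part of `φ`. -/
def GP {X : Type*} [NormedAddCommGroup X] {A : Subalgebra ℂ (UnitBall X →ᵇ ℂ)}
    (φ : A →ₐ[ℂ] ℂ) : Set (A →ₐ[ℂ] ℂ) :=
  {ψ | rho φ ψ < 1}

/-- The fiber `M_z` of the spectrum over `z`: the homomorphisms whose restriction to `X*`
is `z`. -/
def fiber {X : Type*} [NormedAddCommGroup X] [NormedSpace ℂ X]
    {A : Subalgebra ℂ (UnitBall X →ᵇ ℂ)} (hA : A = Au X ∨ A = Hinf X) (z : Bidual X) :
    Set (A →ₐ[ℂ] ℂ) :=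
  {φ | ∀ L : StrongDual ℂ X, φ ⟨restrictDual L, restrictDual_mem hA L⟩ = z L}

/-- The canonical (Aron–Berner) extension of a continuous `n`-linear form `T` on `X` to the
bidual, `T ↦ T̃(z₁, …, zₙ)`. It is defined one variable at a time:
`T̃(z₁, …, zₙ₊₁) = z₁ (x ↦ T(x, ·, …, ·)~(z₂, …, zₙ₊₁))`. Since `z(L) = lim L(x_α)` for every
`L ∈ X*` whenever `x_α → z` weak-star, this is the iterated weak-star limit
`lim_{x₁ → z₁} ⋯ lim_{xₙ → zₙ} T(x₁, …, xₙ)`. -/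
def multilinearExtension {X : Type*} [NormedAddCommGroup X] [NormedSpace ℂ X] :
    (n : ℕ) → (Fin n → Bidual X) →
      (ContinuousMultilinearMap ℂ (fun _ : Fin n => X) ℂ →L[ℂ] ℂ)
  | 0, _ =>
      ((continuousMultilinearCurryFin0 ℂ X ℂ).toContinuousLinearEquiv :
        ContinuousMultilinearMap ℂ (fun _ : Fin 0 => X) ℂ →L[ℂ] ℂ)
  | n + 1, z =>
      (z 0).comp
        ((ContinuousLinearMap.compL ℂ X (ContinuousMultilinearMap ℂ (fun _ : Fin n => X) ℂ) ℂ
            (multilinearExtension n (Fin.tail z))).comp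
          ((continuousMultilinearCurryLeftEquiv ℂ (fun _ : Fin (n + 1) => X)
              ℂ).toContinuousLinearEquiv :
            ContinuousMultilinearMap ℂ (fun _ : Fin (n + 1) => X) ℂ →L[ℂ]
              (X →L[ℂ] ContinuousMultilinearMap ℂ (fun _ : Fin n => X) ℂ)))

/-- The symmetric `n`-linear form of the `n`-th Taylor polynomial of `f` at `0`. -/
def taylorForm {X : Type*} [NormedAddCommGroup X] [NormedSpace ℂ X] (f : UnitBall X → ℂ)
    (n : ℕ) : ContinuousMultilinearMap ℂ (fun _ : Fin n => X) ℂ :=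
  ((n.factorial : ℂ)⁻¹) • iteratedFDeriv ℂ n (ext0 f) 0

/-- `P̃ₙ(z)`, the canonical extension of the `n`-th homogeneous Taylor polynomial `Pₙ` of `f`
at `0`, evaluated at `z ∈ X**`. -/
def taylorExtension {X : Type*} [NormedAddCommGroup X] [NormedSpace ℂ X] (f : UnitBall X → ℂ)
    (z : Bidual X) (n : ℕ) : ℂ :=
  multilinearExtension n (fun _ => z) (taylorForm f n)

/-- The canonical extension `f̃(z) = ∑ₙ P̃ₙ(z)` of `f` to the open unit ball of `X**`. -/
def canonicalExtension {X : Type*} [NormedAddCommGroup X] [NormedSpace ℂ X]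
    (f : UnitBall X → ℂ) (z : Bidual X) : ℂ :=
  ∑' n, taylorExtension f z n

end BallAlgebra

end

/-!
Choosing `m` points of the ball one after the other by Goldstine's theorem and averaging them gives
points `u` of the ball at which `P(u)` is close to `P̃(z)` for any finite set of homogeneous
polynomials `P` (Davie and Gamelin). Hence `f̃(z)` is a limit of the values `f(u)`, along a filter
independent of `f`, and `δ_z` is a character. Schwarz's lemma on complex lines through `0` bounds
`ρ(δ_0, δ_z)` from above. Functionals in `X*` composed with Möbius transformations of the disc bound
`ρ` from below by pseudo-hyperbolic distances, which tend to `1` over the unit sphere of `X**`.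
-/

noncomputable section

namespace BallAlgebra

open Filter Topology
open scoped ComplexConjugate ContDiff

section Goldstine

variable {𝕜 E : Type*} [RCLike 𝕜] [NormedAddCommGroup E] [NormedSpace 𝕜 E]

theorem opNorm_le_div_of_re_apply_le {L : StrongDual 𝕜 E} {r u : ℝ} (hr : 0 < r)
    (hL : ∀ x, ‖x‖ < r → RCLike.re (L x) ≤ u) : ‖L‖ ≤ u / r := by
  by_contra! hlt
  obtain ⟨x, hx, hux⟩ := L.exists_lt_apply_of_lt_opNorm hlt
  obtain ⟨c, hc, hcx⟩ := RCLike.exists_norm_eq_mul_self (L x)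
  have hre : RCLike.re (L ((r : 𝕜) • c • x)) = r * ‖L x‖ := by
    rw [L.map_smul, L.map_smul, smul_eq_mul, smul_eq_mul, ← hcx, RCLike.re_ofReal_mul,
      RCLike.ofReal_re]
  have hle : r * ‖L x‖ ≤ u := hre ▸ hL _ (by
    rw [norm_smul, norm_smul, hc, one_mul, RCLike.norm_ofReal, abs_of_pos hr]
    exact mul_lt_of_lt_one_right hr hx)
  rw [div_lt_iff₀' hr] at hux
  exact hux.not_ge hle

theorem bidual_apply_comp_pi {ι : Type*} [Finite ι] (z : StrongDual 𝕜 (StrongDual 𝕜 E))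
    (l : ι → StrongDual 𝕜 E) (f : StrongDual 𝕜 (ι → 𝕜)) :
    z (f.comp (ContinuousLinearMap.pi l)) = f fun i => z (l i) := by
  classical
  have := Fintype.ofFinite ι
  have hf (v : ι → 𝕜) : f v = ∑ i, v i * f (Pi.single i 1) := by
    conv_lhs => rw [pi_eq_sum_univ' v]
    simp only [map_sum, map_smul, smul_eq_mul]
  have hcomp : f.comp (ContinuousLinearMap.pi l) = ∑ i, f (Pi.single i 1) • l i := by
    ext x
    simpa [mul_comm] using hf fun i => l i x
  rw [hcomp, hf]
  simp [mul_comm]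

theorem goldstine_finite {ι : Type*} [Finite ι] (z : StrongDual 𝕜 (StrongDual 𝕜 E))
    (l : ι → StrongDual 𝕜 E) {r ε : ℝ} (hz : ‖z‖ < r) (hε : 0 < ε) :
    ∃ x : E, ‖x‖ < r ∧ ∀ i, ‖l i x - z (l i)‖ < ε := by
  have := Fintype.ofFinite ι
  let _ : NormedSpace ℝ E := NormedSpace.restrictScalars ℝ 𝕜 E
  have : IsScalarTower ℝ 𝕜 E := .of_algebraMap_smul fun _ _ => rfl
  have hr : 0 < r := (norm_nonneg z).trans_lt hz
  let Λ : E →L[𝕜] (ι → 𝕜) := ContinuousLinearMap.pi l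
  have hmem : (fun i => z (l i)) ∈ closure (Λ '' Metric.ball (0 : E) r) := by
    by_contra hy
    have hconv : Convex ℝ (Λ '' Metric.ball (0 : E) r) :=
      (convex_ball (0 : E) r).is_linear_image (Λ.toLinearMap.restrictScalars ℝ).isLinear
    obtain ⟨f, u, hu, hfz⟩ := RCLike.geometric_hahn_banach_closed_point (𝕜 := 𝕜)
      hconv.closure isClosed_closure hy
    have hnorm : ‖f.comp Λ‖ ≤ u / r := opNorm_le_div_of_re_apply_le hr fun x hx =>
      (hu _ (subset_closure ⟨x, by simpa using hx, rfl⟩)).le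
    refine hfz.not_ge ?_
    calc RCLike.re (f fun i => z (l i)) ≤ ‖z (f.comp Λ)‖ := by
          rw [← bidual_apply_comp_pi]
          exact RCLike.re_le_norm _
      _ ≤ r * (u / r) := (z.le_opNorm _).trans (by gcongr)
      _ = u := mul_div_cancel₀ u hr.ne'
  obtain ⟨_, ⟨x, hx, rfl⟩, hd⟩ := Metric.mem_closure_iff.1 hmem ε hε
  refine ⟨x, by simpa using hx, fun i => ?_⟩
  rw [dist_comm, dist_pi_lt_iff hε] at hd
  simpa [dist_eq_norm, Λ] using hd i

end Goldstine

section Average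

variable {𝕜 E F : Type*} [RCLike 𝕜] [NormedAddCommGroup E] [NormedSpace 𝕜 E]
  [NormedAddCommGroup F] [NormedSpace 𝕜 F] {m n : ℕ}

theorem norm_average_le {x : Fin m → E} {r : ℝ} (hr : 0 ≤ r) (hx : ∀ k, ‖x k‖ ≤ r) :
    ‖(m : 𝕜)⁻¹ • ∑ k, x k‖ ≤ r := by
  rw [norm_smul, norm_inv, RCLike.norm_natCast]
  refine inv_mul_le_of_le_mul₀ m.cast_nonneg hr ?_
  simpa using norm_sum_le_of_le Finset.univ fun k _ => hx k

theorem map_average_eq_average (T : E [×n]→L[𝕜] F) (x : Fin m → E) :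
    (T fun _ => (m : 𝕜)⁻¹ • ∑ k, x k) = ((m : 𝕜) ^ n)⁻¹ • ∑ j : Fin n → Fin m, T (x ∘ j) := by
  rw [T.map_smul_univ (fun _ => (m : 𝕜)⁻¹) fun _ => ∑ k, x k, T.map_sum]
  simp [Function.comp_def]

theorem map_average_sub_eq_average (T : E [×n]→L[𝕜] F) (x : Fin m → E) (c : F) (hm : m ≠ 0) :
    (T fun _ => (m : 𝕜)⁻¹ • ∑ k, x k) - c =
      ((m : 𝕜) ^ n)⁻¹ • ∑ j : Fin n → Fin m, (T (x ∘ j) - c) := by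
  have hm' : (m : 𝕜) ^ n ≠ 0 := pow_ne_zero n (Nat.cast_ne_zero.2 hm)
  rw [map_average_eq_average, Finset.sum_sub_distrib, smul_sub, Finset.sum_const,
    Finset.card_univ, Fintype.card_fun, Fintype.card_fin, Fintype.card_fin,
    ← Nat.cast_smul_eq_nsmul 𝕜, Nat.cast_pow, inv_smul_smul₀ hm']

theorem card_filter_injective (n m : ℕ) :
    (Finset.univ.filter fun j : Fin n → Fin m => Function.Injective j).card =
      m.descFactorial n := by
  rw [← Fintype.card_subtype,
    Fintype.card_congr (Equiv.subtypeInjectiveEquivEmbedding (Fin n) (Fin m)),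
    Fintype.card_embedding_eq, Fintype.card_fin, Fintype.card_fin]

theorem norm_map_average_sub_le {T : E [×n]→L[𝕜] F} {x : Fin m → E} {c : F} {ε B : ℝ}
    (hm : 0 < m) (hε : 0 ≤ ε)
    (hinj : ∀ j : Fin n → Fin m, Function.Injective j → ‖T (x ∘ j) - c‖ ≤ ε)
    (hB : ∀ j : Fin n → Fin m, ‖T (x ∘ j) - c‖ ≤ B) :
    ‖(T fun _ => (m : 𝕜)⁻¹ • ∑ k, x k) - c‖ ≤
      ε + (1 - (m.descFactorial n : ℝ) / (m : ℝ) ^ n) * B := by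
  have hm' : (0 : ℝ) < (m : ℝ) ^ n := by positivity
  have hcard : (Finset.univ.filter fun j : Fin n → Fin m => ¬ Function.Injective j).card +
      m.descFactorial n = m ^ n := by
    rw [← card_filter_injective, add_comm, Finset.card_filter_add_card_filter_not]
    simp
  have hdesc : (m.descFactorial n : ℝ) ≤ (m : ℝ) ^ n := by
    exact_mod_cast Nat.descFactorial_le_pow m n
  have hsum : ∑ j : Fin n → Fin m, ‖T (x ∘ j) - c‖ ≤
      m.descFactorial n * ε + ((m : ℝ) ^ n - m.descFactorial n) * B := by
    rw [← Finset.sum_filter_add_sum_filter_not _ fun j : Fin n → Fin m => Function.Injective j]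
    refine add_le_add ?_ ?_
    · rw [← card_filter_injective, ← nsmul_eq_mul]
      exact Finset.sum_le_card_nsmul _ _ _ fun j hj => hinj j (Finset.mem_filter.1 hj).2
    · rw [← Nat.cast_pow, ← hcard, Nat.cast_add, add_sub_cancel_right, ← nsmul_eq_mul]
      exact Finset.sum_le_card_nsmul _ _ _ fun j _ => hB j
  calc ‖(T fun _ => (m : 𝕜)⁻¹ • ∑ k, x k) - c‖
      ≤ ((m : ℝ) ^ n)⁻¹ * ∑ j : Fin n → Fin m, ‖T (x ∘ j) - c‖ := by
        rw [map_average_sub_eq_average T x c hm.ne', norm_smul, norm_inv, norm_pow,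
          RCLike.norm_natCast]
        gcongr
        exact norm_sum_le _ _
    _ ≤ ((m : ℝ) ^ n)⁻¹ * (m.descFactorial n * ε + ((m : ℝ) ^ n - m.descFactorial n) * B) := by
        gcongr
    _ = m.descFactorial n / (m : ℝ) ^ n * ε + (1 - m.descFactorial n / (m : ℝ) ^ n) * B := by
        field_simp
    _ ≤ ε + (1 - m.descFactorial n / (m : ℝ) ^ n) * B := by
        gcongr
        exact mul_le_of_le_one_left hε ((div_le_one hm').2 hdesc)

theorem tendsto_descFactorial_div_pow (n : ℕ) :
    Tendsto (fun m : ℕ => (m.descFactorial n : ℝ) / (m : ℝ) ^ n) atTop (𝓝 1) := by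
  have hne : ∀ᶠ m : ℕ in atTop, (m : ℝ) ^ n ≠ 0 := by
    filter_upwards [eventually_ne_atTop 0] with m hm
    positivity
  exact (Asymptotics.isEquivalent_iff_tendsto_one hne).1 (isEquivalent_descFactorial n)

end Average

section BidualExtension

variable {X : Type*} [NormedAddCommGroup X] [NormedSpace ℂ X]

theorem multilinearExtension_succ_apply {n : ℕ} (z : Fin (n + 1) → Bidual X)
    (T : X [×(n + 1)]→L[ℂ] ℂ) :
    multilinearExtension (n + 1) z T =
      z 0 ((multilinearExtension n (Fin.tail z)).comp T.curryLeft) :=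
  rfl

theorem multilinearExtension_one (z : Bidual X) (L : StrongDual ℂ X) :
    multilinearExtension 1 (fun _ => z) ((continuousMultilinearCurryFin1 ℂ X ℂ).symm L) =
      z L :=
  rfl

theorem multilinearExtension_smul (n : ℕ) (c : ℂ) (z : Fin n → Bidual X)
    (T : X [×n]→L[ℂ] ℂ) :
    multilinearExtension n (fun i => c • z i) T = c ^ n * multilinearExtension n z T := by
  induction n with
  | zero => exact (one_mul _).symm.trans (by rw [pow_zero]; rfl)
  | succ n ih =>
    have hcomp : (multilinearExtension n (Fin.tail fun i => c • z i)).comp T.curryLeft =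
        c ^ n • (multilinearExtension n (Fin.tail z)).comp T.curryLeft :=
      ContinuousLinearMap.ext fun x => ih (Fin.tail z) (T.curryLeft x)
    rw [multilinearExtension_succ_apply, multilinearExtension_succ_apply, hcomp]
    simp only [smul_apply, map_smul, smul_eq_mul]
    ring

end BidualExtension

/-- A continuous multilinear form on `X` together with its number of variables, so that one finite
set can hold forms of different degrees. -/
abbrev MultilinearForm (X : Type*) [NormedAddCommGroup X] [NormedSpace ℂ X] : Type _ :=
  Σ n : ℕ, X [×n]→L[ℂ] ℂ

namespace MultilinearForm

variable {X : Type*} [NormedAddCommGroup X] [NormedSpace ℂ X]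

/-- The value `T̃(z, …, z)` of the canonical extension on the diagonal. -/
def bidualValue (z : Bidual X) (T : MultilinearForm X) : ℂ :=
  multilinearExtension T.1 (fun _ => z) T.2

/-- The functional `x ↦ T(x, ·, …, ·)~(z, …, z)`, whose value under `z` is `T̃(z, …, z)`. A form
without variables has no first argument and gets the functional `0`. -/
def headFunctional (z : Bidual X) : MultilinearForm X → StrongDual ℂ X
  | ⟨0, _⟩ => 0
  | ⟨n + 1, T⟩ => (multilinearExtension n fun _ => z).comp T.curryLeft

/-- The form `T(x, ·, …, ·)` with the first argument frozen; a form without variables is left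
unchanged. -/
def fixHead (x : X) : MultilinearForm X → MultilinearForm X
  | ⟨0, T⟩ => ⟨0, T⟩
  | ⟨n + 1, T⟩ => ⟨n, T.curryLeft x⟩

/-- Symmetry: invariance under permutations of the arguments. -/
def IsSymmetric (T : MultilinearForm X) : Prop :=
  ∀ (σ : Equiv.Perm (Fin T.1)) (v : Fin T.1 → X), T.2 (v ∘ σ) = T.2 v

end MultilinearForm

theorem exists_strictMono_eq_succ_comp {n m : ℕ} {j : Fin n → Fin (m + 1)} (hj : StrictMono j)
    (h0 : ∀ i, j i ≠ 0) : ∃ j' : Fin n → Fin m, StrictMono j' ∧ j = Fin.succ ∘ j' :=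
  ⟨fun i => (j i).pred (h0 i), fun _ _ h => Fin.pred_lt_pred_iff.2 (hj h),
    funext fun i => (Fin.succ_pred _ (h0 i)).symm⟩

section DavieGamelin

variable {X : Type*} [NormedAddCommGroup X] [NormedSpace ℂ X]

open MultilinearForm

theorem apply_eq_bidualValue_of_degree_zero (z : Bidual X) (T : X [×0]→L[ℂ] ℂ)
    (v : Fin 0 → X) : T v = bidualValue z ⟨0, T⟩ := by
  rw [Subsingleton.elim v 0]
  rfl

/-- The points are chosen one after the other: the new `x₀` approximates `z` on the functionals
obtained from the forms by extending all later variables to `z`, after which the remaining points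
have to deal with the given forms and with those whose first argument is frozen at `x₀`. -/
theorem exists_forall_strictMono_norm_sub_bidualValue_le {z : Bidual X} {r : ℝ} (hz : ‖z‖ < r)
    (m : ℕ) {S : Set (MultilinearForm X)} (hS : S.Finite) {ε : ℝ} (hε : 0 < ε) :
    ∃ x : Fin m → X, (∀ k, ‖x k‖ < r) ∧ ∀ T ∈ S, ∀ j : Fin T.1 → Fin m, StrictMono j →
      ‖T.2 (x ∘ j) - bidualValue z T‖ ≤ ε := by
  induction m generalizing S ε with
  | zero =>
    refine ⟨Fin.elim0, fun k => k.elim0, ?_⟩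
    rintro ⟨_ | n, T⟩ - j -
    · simp [← apply_eq_bidualValue_of_degree_zero z T (Fin.elim0 ∘ j), hε.le]
    · exact (j 0).elim0
  | succ m ih =>
    have := hS.to_subtype
    obtain ⟨x₀, hx₀, hhead⟩ :=
      goldstine_finite z (fun T : S => headFunctional z T) hz (half_pos hε)
    obtain ⟨x, hx, htail⟩ := ih (hS.union (hS.image (fixHead x₀))) (half_pos hε)
    refine ⟨Fin.cons x₀ x, Fin.cases hx₀ hx, ?_⟩
    rintro ⟨_ | n, T⟩ hT j hj
    · simp [← apply_eq_bidualValue_of_degree_zero z T (Fin.cons x₀ x ∘ j), hε.le]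
    have hpos (i : Fin n) : j i.succ ≠ 0 := ((Fin.zero_le _).trans_lt (hj i.succ_pos)).ne'
    by_cases h0 : j 0 = 0
    · obtain ⟨j', hj', hjj'⟩ := exists_strictMono_eq_succ_comp
        (j := fun i : Fin n => j i.succ) (fun _ _ h => hj (Fin.succ_lt_succ_iff.2 h)) hpos
      have hval : Fin.cons x₀ x ∘ j = Fin.cons x₀ (x ∘ j') := by
        funext i
        refine Fin.cases ?_ (fun i => ?_) i
        · simp [h0]
        · simp [show j i.succ = (j' i).succ from congrFun hjj' i]
      have hfix : ‖T (Fin.cons x₀ (x ∘ j')) - headFunctional z ⟨n + 1, T⟩ x₀‖ ≤ ε / 2 :=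
        htail _ (Or.inr ⟨_, hT, rfl⟩) j' hj'
      have hext : ‖headFunctional z ⟨n + 1, T⟩ x₀ - bidualValue z ⟨n + 1, T⟩‖ ≤ ε / 2 :=
        (hhead ⟨_, hT⟩).le
      rw [hval, ← add_halves ε]
      exact (norm_sub_le_norm_sub_add_norm_sub _ _ _).trans (add_le_add hfix hext)
    · obtain ⟨j', hj', rfl⟩ := exists_strictMono_eq_succ_comp hj (Fin.cases h0 hpos)
      exact (htail _ (Or.inl hT) j' hj').trans (half_le_self hε.le)

theorem norm_sub_bidualValue_le_of_injective {T : MultilinearForm X} (hT : T.IsSymmetric)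
    {z : Bidual X} {m : ℕ} {x : Fin m → X} {ε : ℝ}
    (hx : ∀ j : Fin T.1 → Fin m, StrictMono j → ‖T.2 (x ∘ j) - bidualValue z T‖ ≤ ε)
    {j : Fin T.1 → Fin m} (hj : Function.Injective j) :
    ‖T.2 (x ∘ j) - bidualValue z T‖ ≤ ε := by
  rw [← hT (Tuple.sort j) (x ∘ j), Function.comp_assoc]
  exact hx _ ((Tuple.monotone_sort j).strictMono_of_injective
    (hj.comp (Tuple.sort j).injective))

theorem norm_comp_le {n m : ℕ} (T : X [×n]→L[ℂ] ℂ) {x : Fin m → X} {r : ℝ}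
    (hx : ∀ k, ‖x k‖ ≤ r) (j : Fin n → Fin m) : ‖T (x ∘ j)‖ ≤ ‖T‖ * r ^ n := by
  refine (T.le_opNorm _).trans ?_
  gcongr
  exact (Finset.prod_le_prod (fun _ _ => norm_nonneg _) fun i _ => hx (j i)).trans (by simp)

/-- Among the `m ^ n` terms of `T` at the average of `m` points, those without repeated points
dominate as `m` grows, and they are close to `T̃(z, …, z)`. -/
theorem exists_norm_le_forall_norm_sub_bidualValue_le {z : Bidual X} {r : ℝ} (hz : ‖z‖ < r)
    {S : Set (MultilinearForm X)} (hS : S.Finite) (hsymm : ∀ T ∈ S, T.IsSymmetric) {ε : ℝ}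
    (hε : 0 < ε) :
    ∃ u : X, ‖u‖ ≤ r ∧ ∀ T ∈ S, ‖(T.2 fun _ => u) - bidualValue z T‖ ≤ ε := by
  let B (T : MultilinearForm X) : ℝ := ‖T.2‖ * r ^ T.1 + ‖bidualValue z T‖
  have hrepeat : ∀ᶠ m : ℕ in atTop,
      ∀ T ∈ S, (1 - (m.descFactorial T.1 : ℝ) / (m : ℝ) ^ T.1) * B T ≤ ε / 2 := by
    refine (eventually_all_finite hS).2 fun T _ => ?_
    have hlim := ((tendsto_descFactorial_div_pow T.1).const_sub 1).mul_const (B T)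
    rw [sub_self, zero_mul] at hlim
    exact hlim.eventually_le_const (half_pos hε)
  obtain ⟨m, hrepeat, hm⟩ := (hrepeat.and (eventually_gt_atTop 0)).exists
  obtain ⟨x, hx, happrox⟩ :=
    exists_forall_strictMono_norm_sub_bidualValue_le hz m hS (half_pos hε)
  refine ⟨(m : ℂ)⁻¹ • ∑ k, x k,
    norm_average_le ((norm_nonneg z).trans hz.le) fun k => (hx k).le, fun T hT => ?_⟩
  have havg := norm_map_average_sub_le (𝕜 := ℂ) (T := T.2) (B := B T) hm (half_pos hε).le
    (fun j hj => norm_sub_bidualValue_le_of_injective (hsymm T hT) (happrox T hT) hj)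
    fun j => norm_sub_le_of_le (norm_comp_le T.2 (fun k => (hx k).le) j) le_rfl
  linarith [hrepeat T hT]

theorem exists_filter_tendsto_bidualValue {z : Bidual X} {r : ℝ} (hz : ‖z‖ < r) (hr : r < 1) :
    ∃ l : Filter (UnitBall X), l.NeBot ∧ (∀ᶠ x : UnitBall X in l, ‖(x : X)‖ ≤ r) ∧
      ∀ T : MultilinearForm X, T.IsSymmetric →
        Tendsto (fun x : UnitBall X => T.2 fun _ => (x : X)) l (𝓝 (bidualValue z T)) := by
  classical
  choose u hu hdist using fun p : Finset (MultilinearForm X) × ℕ =>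
    exists_norm_le_forall_norm_sub_bidualValue_le hz
      (p.1.finite_toSet.subset (Set.sep_subset _ IsSymmetric)) (fun T hT => hT.2)
      (Nat.one_div_pos_of_nat (α := ℝ) (n := p.2))
  let v (p : Finset (MultilinearForm X) × ℕ) : UnitBall X :=
    ⟨u p, mem_ball_zero_iff.2 ((hu p).trans_lt hr)⟩
  refine ⟨map v atTop, map_neBot, eventually_map.2 (.of_forall hu), fun T hT => ?_⟩
  rw [tendsto_map'_iff, tendsto_iff_norm_sub_tendsto_zero]
  have hsnd : Tendsto (Prod.snd : Finset (MultilinearForm X) × ℕ → ℕ) atTop atTop := by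
    rw [← prod_atTop_atTop_eq]
    exact tendsto_snd
  refine squeeze_zero' (Eventually.of_forall fun _ => norm_nonneg _) ?_
    (tendsto_one_div_add_atTop_nhds_zero_nat.comp hsnd)
  filter_upwards [eventually_ge_atTop (({T}, 0) : Finset (MultilinearForm X) × ℕ)] with p hp
  exact hdist p T ⟨hp.1 (Finset.mem_singleton_self T), hT⟩

end DavieGamelin

section TaylorSeries

theorem norm_coe_unitBall_lt_one {E : Type*} [NormedAddCommGroup E] (x : UnitBall E) :
    ‖(x : E)‖ < 1 :=
  mem_ball_zero_iff.1 x.2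

theorem iteratedDeriv_comp_smul_eq_iteratedFDeriv {𝕜 E F : Type*} [NontriviallyNormedField 𝕜]
    [NormedAddCommGroup E] [NormedSpace 𝕜 E] [NormedAddCommGroup F] [NormedSpace 𝕜 F]
    {g : E → F} {U : Set E} {n : ℕ} (hg : ContDiffOn 𝕜 n g U) (hU : IsOpen U) (h0 : 0 ∈ U)
    (x : E) :
    iteratedDeriv n (fun c : 𝕜 => g (c • x)) 0 = iteratedFDeriv 𝕜 n g 0 fun _ => x := by
  let L : 𝕜 →L[𝕜] E := ContinuousLinearMap.toSpanSingleton 𝕜 x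
  have hLU : IsOpen (L ⁻¹' U) := hU.preimage L.continuous
  have hL0 : (0 : 𝕜) ∈ L ⁻¹' U := by simpa using h0
  have h := L.iteratedFDerivWithin_comp_right hg hU.uniqueDiffOn hLU.uniqueDiffOn hL0 le_rfl
  rw [iteratedFDerivWithin_of_isOpen n hLU hL0, map_zero,
    iteratedFDerivWithin_of_isOpen n hU h0] at h
  simpa [iteratedDeriv_eq_iteratedFDeriv, Function.comp_def, L] using
    congrArg (fun T => T fun _ => (1 : 𝕜)) h

theorem norm_smul_lt_one_of_mem_closedBall_inv {E : Type*} [NormedAddCommGroup E] [NormedSpace ℂ E]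
    {x : E} {s : ℝ} (hx : ‖x‖ < s) {c : ℂ} (hc : c ∈ Metric.closedBall (0 : ℂ) s⁻¹) :
    ‖c • x‖ < 1 := by
  have hs : 0 < s := (norm_nonneg x).trans_lt hx
  calc ‖c • x‖ = ‖c‖ * ‖x‖ := norm_smul _ _
    _ ≤ s⁻¹ * ‖x‖ := by gcongr; exact mem_closedBall_zero_iff.1 hc
    _ < s⁻¹ * s := by gcongr
    _ = 1 := inv_mul_cancel₀ hs.ne'

variable {X : Type*} [NormedAddCommGroup X] [NormedSpace ℂ X]

theorem iteratedDeriv_ext0_smul {f : UnitBall X → ℂ} (hf : IsHolo f) (x : X) (n : ℕ) :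
    iteratedDeriv n (fun c : ℂ => ext0 f (c • x)) 0 = n.factorial * taylorForm f n fun _ => x := by
  rw [iteratedDeriv_comp_smul_eq_iteratedFDeriv
    (hf.contDiffOn Metric.isOpen_ball.uniqueDiffOn) Metric.isOpen_ball
    (Metric.mem_ball_self one_pos)]
  simp [taylorForm, Nat.factorial_ne_zero]

theorem isSymmetric_taylorForm {f : UnitBall X → ℂ} (hf : IsHolo f) (n : ℕ) :
    MultilinearForm.IsSymmetric ⟨n, taylorForm f n⟩ := fun σ v => by
  have h : ContDiffAt ℂ ω (ext0 f) 0 := (hf 0 (Metric.mem_ball_self one_pos)).contDiffAt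
  simp only [taylorForm, smul_apply, h.iteratedFDeriv_comp_perm]

theorem differentiableOn_ext0_smul {f : UnitBall X → ℂ} (hf : IsHolo f) {x : X} {s : ℝ}
    (hx : ‖x‖ < s) :
    DifferentiableOn ℂ (fun c : ℂ => ext0 f (c • x)) (Metric.closedBall 0 s⁻¹) := fun c hc =>
  have hcx := mem_ball_zero_iff.2 (norm_smul_lt_one_of_mem_closedBall_inv hx hc)
  ((hf _ hcx).differentiableAt.comp c (differentiableAt_id.smul_const x)).differentiableWithinAt

theorem hasSum_taylorForm {f : UnitBall X → ℂ} (hf : IsHolo f) (x : UnitBall X) :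
    HasSum (fun n => taylorForm f n fun _ => (x : X)) (f x) := by
  obtain ⟨s, hxs, hs1⟩ := exists_between (norm_coe_unitBall_lt_one x)
  have hs : 0 < s := (norm_nonneg _).trans_lt hxs
  have h := Complex.hasSum_taylorSeries_on_ball (z := 1)
    ((differentiableOn_ext0_smul hf hxs).mono Metric.ball_subset_closedBall)
    (by simpa using (one_lt_inv₀ hs).2 hs1)
  simpa [iteratedDeriv_ext0_smul hf, ext0_apply, Nat.factorial_ne_zero] using h

theorem norm_taylorForm_le {f : UnitBall X →ᵇ ℂ} (hf : IsHolo f) {x : X} {s : ℝ}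
    (hx : ‖x‖ < s) (n : ℕ) : ‖taylorForm f n fun _ => x‖ ≤ ‖f‖ * s ^ n := by
  have hs : 0 < s := (norm_nonneg _).trans_lt hx
  have hbound : ∀ c ∈ Metric.sphere (0 : ℂ) s⁻¹, ‖ext0 f (c • x)‖ ≤ ‖f‖ := fun c hc => by
    have hcx := norm_smul_lt_one_of_mem_closedBall_inv hx (Metric.sphere_subset_closedBall hc)
    exact (ext0_apply f ⟨c • x, mem_ball_zero_iff.2 hcx⟩).symm ▸ f.norm_coe_le_norm _
  have hcauchy := Complex.norm_iteratedDeriv_le_of_forall_mem_sphere_norm_le n (inv_pos.2 hs)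
    ((differentiableOn_ext0_smul hf hx).diffContOnCl_ball subset_rfl) hbound
  rw [iteratedDeriv_ext0_smul hf, norm_mul, Complex.norm_natCast, mul_div_assoc, inv_pow,
    div_inv_eq_mul] at hcauchy
  exact le_of_mul_le_mul_left hcauchy (by positivity)

theorem taylorExtension_smul (f : UnitBall X → ℂ) (c : ℂ) (z : Bidual X) (n : ℕ) :
    taylorExtension f (c • z) n = c ^ n * taylorExtension f z n :=
  multilinearExtension_smul n c (fun _ => z) _

theorem summable_taylorExtension_and_tendsto_canonicalExtension {f : UnitBall X →ᵇ ℂ}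
    (hf : IsHolo f) {z : Bidual X} {l : Filter (UnitBall X)} [l.NeBot] {r : ℝ} (hr : r < 1)
    (hl : ∀ᶠ x : UnitBall X in l, ‖(x : X)‖ ≤ r)
    (hlim : ∀ n, Tendsto (fun x : UnitBall X => taylorForm f n fun _ => (x : X)) l
      (𝓝 (taylorExtension f z n))) :
    Summable (taylorExtension f z) ∧ Tendsto f l (𝓝 (canonicalExtension f z)) := by
  obtain ⟨s, hrs, hs1⟩ := exists_between hr
  obtain ⟨x₀, hx₀⟩ := hl.exists
  have hgeom : Summable fun n : ℕ => ‖f‖ * s ^ n :=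
    (summable_geometric_of_lt_one ((norm_nonneg _).trans (hx₀.trans hrs.le)) hs1).mul_left _
  have hdom : ∀ᶠ x : UnitBall X in l,
      ∀ n, ‖taylorForm f n fun _ => (x : X)‖ ≤ ‖f‖ * s ^ n := by
    filter_upwards [hl] with x hx n using norm_taylorForm_le hf (hx.trans_lt hrs) n
  refine ⟨.of_norm_bounded hgeom fun n =>
    le_of_tendsto (hlim n).norm (hdom.mono fun x hx => hx n), ?_⟩
  exact (tendsto_tsum_of_dominated_convergence hgeom hlim hdom).congr fun x =>
    (hasSum_taylorForm hf x).tsum_eq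

theorem exists_filter_tendsto_canonicalExtension {z : Bidual X} (hz : ‖z‖ < 1) :
    ∃ l : Filter (UnitBall X), l.NeBot ∧
      (∀ L : StrongDual ℂ X, Tendsto (fun x : UnitBall X => L x) l (𝓝 (z L))) ∧
      ∀ f : UnitBall X →ᵇ ℂ, IsHolo f →
        Summable (taylorExtension f z) ∧ Tendsto f l (𝓝 (canonicalExtension f z)) := by
  obtain ⟨r, hzr, hr⟩ := exists_between hz
  obtain ⟨l, hl, hlr, hlim⟩ := exists_filter_tendsto_bidualValue hzr hr
  refine ⟨l, hl, fun L => ?_, fun f hf => ?_⟩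
  · rw [← multilinearExtension_one z L]
    exact hlim ⟨1, (continuousMultilinearCurryFin1 ℂ X ℂ).symm L⟩ fun σ v => by
      rw [Subsingleton.elim σ 1]
      rfl
  · exact summable_taylorExtension_and_tendsto_canonicalExtension hf hr hlr fun n =>
      hlim _ (isSymmetric_taylorForm hf n)

theorem differentiableOn_canonicalExtension_smul {f : UnitBall X → ℂ} {z : Bidual X} {R : ℝ}
    (hR : 0 ≤ R) (hsum : Summable (taylorExtension f ((R : ℂ) • z))) :
    DifferentiableOn ℂ (fun c : ℂ => canonicalExtension f (c • z)) (Metric.ball 0 R) := by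
  refine Complex.differentiableOn_tsum_of_summable_norm hsum.norm (fun n => ?_)
    Metric.isOpen_ball fun n c hc => ?_
  · simp only [taylorExtension_smul]
    fun_prop
  · have hcR : ‖c‖ ≤ R := (mem_ball_zero_iff.1 hc).le
    simp only [taylorExtension_smul, norm_mul, norm_pow, Complex.norm_real, Real.norm_eq_abs,
      abs_of_nonneg hR]
    gcongr

end TaylorSeries

section PseudoHyperbolic

/-- The pseudo-hyperbolic distance `|a - b| / |1 - b̄ a|` on the closed unit disc. It takes the
junk value `0` where the denominator vanishes, that is, at `a = b` on the unit circle. -/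
def pseudoHyperbolic (a b : ℂ) : ℝ :=
  ‖(a - b) / (1 - conj b * a)‖

theorem norm_sq_one_sub_conj_mul_sub_norm_sq (a b : ℂ) :
    ‖1 - conj b * a‖ ^ 2 - ‖a - b‖ ^ 2 = (1 - ‖a‖ ^ 2) * (1 - ‖b‖ ^ 2) := by
  simp only [← Complex.normSq_eq_norm_sq, Complex.normSq_apply, Complex.sub_re, Complex.sub_im,
    Complex.one_re, Complex.one_im, Complex.mul_re, Complex.mul_im, Complex.conj_re,
    Complex.conj_im]
  ring

theorem one_sub_norm_le_norm_one_sub_conj_mul {a b : ℂ} (ha : ‖a‖ ≤ 1) :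
    1 - ‖b‖ ≤ ‖1 - conj b * a‖ := by
  have h := norm_sub_norm_le (1 : ℂ) (conj b * a)
  rw [norm_one, norm_mul, RCLike.norm_conj] at h
  linarith [mul_le_of_le_one_right (norm_nonneg b) ha]

theorem one_sub_conj_mul_ne_zero {a b : ℂ} (ha : ‖a‖ ≤ 1) (hb : ‖b‖ < 1) :
    1 - conj b * a ≠ 0 :=
  norm_pos_iff.1 ((sub_pos.2 hb).trans_le (one_sub_norm_le_norm_one_sub_conj_mul ha))

theorem pseudoHyperbolic_zero_left (b : ℂ) : pseudoHyperbolic 0 b = ‖b‖ := by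
  simp [pseudoHyperbolic]

theorem pseudoHyperbolic_le_one {a b : ℂ} (ha : ‖a‖ ≤ 1) (hb : ‖b‖ ≤ 1) :
    pseudoHyperbolic a b ≤ 1 := by
  rw [pseudoHyperbolic, norm_div]
  refine div_le_one_of_le₀ (le_of_sq_le_sq ?_ (norm_nonneg _)) (norm_nonneg _)
  have hprod : 0 ≤ (1 - ‖a‖ ^ 2) * (1 - ‖b‖ ^ 2) :=
    mul_nonneg (sub_nonneg.2 (pow_le_one₀ (norm_nonneg _) ha))
      (sub_nonneg.2 (pow_le_one₀ (norm_nonneg _) hb))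
  linarith [norm_sq_one_sub_conj_mul_sub_norm_sq a b]

theorem one_sub_pseudoHyperbolic_sq_mul {a b : ℂ} (ha : ‖a‖ ≤ 1) (hb : ‖b‖ < 1) :
    (1 - pseudoHyperbolic a b ^ 2) * ‖1 - conj b * a‖ ^ 2 = (1 - ‖a‖ ^ 2) * (1 - ‖b‖ ^ 2) := by
  have hden : ‖1 - conj b * a‖ ≠ 0 := norm_ne_zero_iff.2 (one_sub_conj_mul_ne_zero ha hb)
  rw [← norm_sq_one_sub_conj_mul_sub_norm_sq, pseudoHyperbolic, norm_div, div_pow, sub_mul,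
    one_mul, div_mul_cancel₀ _ (pow_ne_zero 2 hden)]

end PseudoHyperbolic

section InverseClosed

variable {α : Type*} [TopologicalSpace α]

/-- Inverse-closedness of a function algebra `A` in the algebra of all bounded continuous
functions. It is what makes the characters of `A` contractive without assuming `A` complete. -/
def IsInverseClosed (A : Subalgebra ℂ (α →ᵇ ℂ)) : Prop :=
  ∀ f ∈ A, ∀ g : α →ᵇ ℂ, f * g = 1 → g ∈ A

variable {A : Subalgebra ℂ (α →ᵇ ℂ)}

theorem IsInverseClosed.isUnit_of_le_norm (hA : IsInverseClosed A) {f : A} {c : ℝ} (hc : 0 < c)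
    (hf : ∀ x, c ≤ ‖(f : α →ᵇ ℂ) x‖) : IsUnit f := by
  have h0 (x : α) : (f : α →ᵇ ℂ) x ≠ 0 := norm_pos_iff.1 (hc.trans_le (hf x))
  let g : α →ᵇ ℂ := BoundedContinuousFunction.ofNormedAddCommGroup
    (fun x => ((f : α →ᵇ ℂ) x)⁻¹) (f.1.continuous.inv₀ h0) c⁻¹ fun x => by
      rw [norm_inv]
      exact inv_anti₀ hc (hf x)
  have hfg : (f : α →ᵇ ℂ) * g = 1 := by
    ext x
    exact mul_inv_cancel₀ (h0 x)
  exact .of_mul_eq_one ⟨g, hA f f.2 g hfg⟩ (Subtype.ext hfg)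

theorem IsInverseClosed.norm_algHom_apply_le (hA : IsInverseClosed A) (φ : A →ₐ[ℂ] ℂ) (f : A) :
    ‖φ f‖ ≤ ‖f‖ := by
  by_contra! hlt
  have hunit : IsUnit (algebraMap ℂ A (φ f) - f) :=
    hA.isUnit_of_le_norm (sub_pos.2 hlt) fun x => calc
      ‖φ f‖ - ‖f‖ ≤ ‖φ f‖ - ‖(f : α →ᵇ ℂ) x‖ := sub_le_sub_left (f.1.norm_coe_le_norm x) _
      _ ≤ ‖φ f - (f : α →ᵇ ℂ) x‖ := norm_sub_norm_le _ _
      _ = ‖((algebraMap ℂ A (φ f) - f : A) : α →ᵇ ℂ) x‖ := by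
        simp [BoundedContinuousFunction.algebraMap_apply]
  simpa using hunit.map φ

theorem IsInverseClosed.exists_moebius (hA : IsInverseClosed A) {f : A} (hf : ‖f‖ ≤ 1) {b : ℂ}
    (hb : ‖b‖ < 1) :
    ∃ m : A, ‖m‖ ≤ 1 ∧ ∀ φ : A →ₐ[ℂ] ℂ, φ m = (φ f - b) / (1 - conj b * φ f) := by
  have hfx (x : α) : ‖(f : α →ᵇ ℂ) x‖ ≤ 1 := (f.1.norm_coe_le_norm x).trans hf
  have hunit : IsUnit (1 - algebraMap ℂ A (conj b) * f) :=
    hA.isUnit_of_le_norm (sub_pos.2 hb) fun x => by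
      simpa [BoundedContinuousFunction.algebraMap_apply] using
        one_sub_norm_le_norm_one_sub_conj_mul (b := b) (hfx x)
  obtain ⟨g, hg⟩ := hunit.exists_left_inv
  refine ⟨(f - algebraMap ℂ A b) * g, ?_, fun φ => ?_⟩
  · refine (BoundedContinuousFunction.norm_le zero_le_one).2 fun x => ?_
    have hgx : (g : α →ᵇ ℂ) x * (1 - conj b * (f : α →ᵇ ℂ) x) = 1 := by
      simpa [BoundedContinuousFunction.algebraMap_apply] using
        congrArg (fun h : A => (h : α →ᵇ ℂ) x) hg
    have hm : ((f - algebraMap ℂ A b : A) * g : α →ᵇ ℂ) x =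
        ((f : α →ᵇ ℂ) x - b) / (1 - conj b * (f : α →ᵇ ℂ) x) := by
      simp [BoundedContinuousFunction.algebraMap_apply, eq_inv_of_mul_eq_one_left hgx,
        div_eq_mul_inv]
    exact (congrArg norm hm).trans_le (pseudoHyperbolic_le_one (hfx x) hb.le)
  · have hφg : φ g * (1 - conj b * φ f) = 1 := by
      simpa using congrArg φ hg
    rw [map_mul, map_sub, AlgHom.commutes, eq_inv_of_mul_eq_one_left hφg, div_eq_mul_inv]
    rfl

end InverseClosed

section GleasonParts

variable {X : Type*} [NormedAddCommGroup X] {A : Subalgebra ℂ (UnitBall X →ᵇ ℂ)}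
  {φ ψ : A →ₐ[ℂ] ℂ}

theorem norm_le_rho (hA : IsInverseClosed A) {f : A} (hf : ‖f‖ ≤ 1) (hψ : ψ f = 0) :
    ‖φ f‖ ≤ rho φ ψ := by
  refine le_csSup ⟨1, ?_⟩ ⟨f, hf, hψ, rfl⟩
  rintro _ ⟨g, hg, -, rfl⟩
  exact (hA.norm_algHom_apply_le φ g).trans hg

theorem rho_le {c : ℝ} (h : ∀ f : A, ‖f‖ ≤ 1 → ψ f = 0 → ‖φ f‖ ≤ c) : rho φ ψ ≤ c := by
  refine csSup_le ⟨0, 0, by simp⟩ ?_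
  rintro _ ⟨f, hf, hψ, rfl⟩
  exact h f hf hψ

theorem rho_nonneg (φ ψ : A →ₐ[ℂ] ℂ) : 0 ≤ rho φ ψ := by
  refine Real.sSup_nonneg ?_
  rintro _ ⟨f, -, -, rfl⟩
  exact norm_nonneg _

theorem rho_le_one (hA : IsInverseClosed A) (φ ψ : A →ₐ[ℂ] ℂ) : rho φ ψ ≤ 1 :=
  rho_le fun f hf _ => (hA.norm_algHom_apply_le φ f).trans hf

theorem mem_GP_self (φ : A →ₐ[ℂ] ℂ) : φ ∈ GP φ :=
  (rho_le fun _ _ hf => (norm_eq_zero.2 hf).le).trans_lt one_pos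

theorem pseudoHyperbolic_apply_le_rho (hA : IsInverseClosed A) {f : A} (hf : ‖f‖ ≤ 1)
    (hψ : ‖ψ f‖ < 1) : pseudoHyperbolic (φ f) (ψ f) ≤ rho φ ψ := by
  obtain ⟨m, hm, hchar⟩ := hA.exists_moebius hf hψ
  rw [pseudoHyperbolic, ← hchar φ]
  exact norm_le_rho hA hm (by rw [hchar ψ, sub_self, zero_div])

theorem rho_le_rho_swap (hA : IsInverseClosed A) (φ ψ : A →ₐ[ℂ] ℂ) : rho φ ψ ≤ rho ψ φ := by
  refine rho_le fun f hf hψ => ?_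
  have hlim : Tendsto (fun c : ℝ => c * ‖φ f‖) (𝓝[<] 1) (𝓝 ‖φ f‖) := by
    simpa using ((continuous_mul_const ‖φ f‖).tendsto 1).mono_left nhdsWithin_le_nhds
  refine le_of_tendsto hlim ?_
  filter_upwards [Ioo_mem_nhdsLT one_pos] with c hc
  have hcnorm : ‖(c : ℂ)‖ = c := by simp [abs_of_pos hc.1]
  have hcφ : ‖φ ((c : ℂ) • f)‖ = c * ‖φ f‖ := by
    rw [φ.map_smul_of_tower, norm_smul, hcnorm]
  have hcψ : ψ ((c : ℂ) • f) = 0 := by rw [ψ.map_smul_of_tower, hψ, smul_zero]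
  have hcf : ‖(c : ℂ) • f‖ ≤ 1 := by
    rw [norm_smul, hcnorm]
    exact mul_le_one₀ hc.2.le (norm_nonneg f) hf
  have hφ1 : ‖φ ((c : ℂ) • f)‖ < 1 := by
    rw [hcφ]
    exact (mul_le_of_le_one_right hc.1.le ((hA.norm_algHom_apply_le φ f).trans hf)).trans_lt hc.2
  simpa only [hcψ, pseudoHyperbolic_zero_left, hcφ] using
    pseudoHyperbolic_apply_le_rho (φ := ψ) hA hcf hφ1

theorem rho_comm (hA : IsInverseClosed A) (φ ψ : A →ₐ[ℂ] ℂ) : rho φ ψ = rho ψ φ :=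
  (rho_le_rho_swap hA φ ψ).antisymm (rho_le_rho_swap hA ψ φ)

end GleasonParts

section BallAlgebras

variable {X : Type*} [NormedAddCommGroup X] [NormedSpace ℂ X]

theorem le_Hinf {A : Subalgebra ℂ (UnitBall X →ᵇ ℂ)} (hA : A = Au X ∨ A = Hinf X) :
    A ≤ Hinf X := by
  rcases hA with rfl | rfl
  exacts [fun _ hf => hf.1, le_rfl]

theorem isInverseClosed_Hinf : IsInverseClosed (Hinf X) := fun f hf g hfg => by
  have hfg' (x : UnitBall X) : f x * g x = 1 := congrArg (fun h : UnitBall X →ᵇ ℂ => h x) hfg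
  refine isHolo_of_eq (g := fun x => (ext0 f x)⁻¹) (AnalyticOnNhd.inv hf fun x hx => ?_)
    fun x => ?_
  · exact (ext0_apply f ⟨x, hx⟩).trans_ne (left_ne_zero_of_mul_eq_one (hfg' ⟨x, hx⟩))
  · rw [ext0_apply]
    exact eq_inv_of_mul_eq_one_right (hfg' x)

theorem isInverseClosed_Au : IsInverseClosed (Au X) := fun f hf g hfg => by
  have hfg' (x : UnitBall X) : f x * g x = 1 := congrArg (fun h : UnitBall X →ᵇ ℂ => h x) hfg
  have hg : (g : UnitBall X → ℂ) = (f : UnitBall X → ℂ)⁻¹ :=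
    funext fun x => eq_inv_of_mul_eq_one_right (hfg' x)
  have hrange : (Set.range f)ᶜ ∈ 𝓝 (0 : ℂ) := by
    refine Metric.mem_nhds_iff.2 ⟨(‖g‖ + 1)⁻¹, by positivity, ?_⟩
    rintro _ hy ⟨x, rfl⟩
    have hfx : ‖f x‖ < (‖g‖ + 1)⁻¹ := mem_ball_zero_iff.1 hy
    have hlt : ‖f x‖ * (‖g‖ + 1) < 1 := by
      rwa [← lt_div_iff₀ (by positivity), one_div]
    refine hlt.not_ge ?_
    calc (1 : ℝ) = ‖f x‖ * ‖g x‖ := by rw [← norm_mul, hfg' x, norm_one]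
      _ ≤ ‖f x‖ * (‖g‖ + 1) := by
        gcongr
        exact (g.norm_coe_le_norm x).trans (le_add_of_nonneg_right zero_le_one)
  exact ⟨isInverseClosed_Hinf f hf.1 g hfg, hg ▸ hf.2.inv₀ hrange⟩

theorem isInverseClosed_of_eq_Au_or_eq_Hinf {A : Subalgebra ℂ (UnitBall X →ᵇ ℂ)}
    (hA : A = Au X ∨ A = Hinf X) : IsInverseClosed A := by
  rcases hA with rfl | rfl
  exacts [isInverseClosed_Au, isInverseClosed_Hinf]

theorem norm_restrictDual_le (L : StrongDual ℂ X) : ‖restrictDual L‖ ≤ ‖L‖ :=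
  BoundedContinuousFunction.norm_ofNormedAddCommGroup_le _ (norm_nonneg L) _

end BallAlgebras

section BidualEvaluation

variable {X : Type*} [NormedAddCommGroup X] [NormedSpace ℂ X] {z : Bidual X}

theorem summable_taylorExtension {f : UnitBall X →ᵇ ℂ} (hf : IsHolo f) (hz : ‖z‖ < 1) :
    Summable (taylorExtension f z) := by
  obtain ⟨_, -, -, hlim⟩ := exists_filter_tendsto_canonicalExtension hz
  exact (hlim f hf).1

theorem canonicalExtension_add {f g : UnitBall X →ᵇ ℂ} (hf : IsHolo f) (hg : IsHolo g)
    (hz : ‖z‖ < 1) :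
    canonicalExtension (f + g : UnitBall X →ᵇ ℂ) z =
      canonicalExtension f z + canonicalExtension g z := by
  obtain ⟨l, _, -, hlim⟩ := exists_filter_tendsto_canonicalExtension hz
  exact tendsto_nhds_unique (hlim _ ((Hinf X).add_mem hf hg)).2
    ((hlim f hf).2.add (hlim g hg).2)

theorem canonicalExtension_mul {f g : UnitBall X →ᵇ ℂ} (hf : IsHolo f) (hg : IsHolo g)
    (hz : ‖z‖ < 1) :
    canonicalExtension (f * g : UnitBall X →ᵇ ℂ) z =
      canonicalExtension f z * canonicalExtension g z := by
  obtain ⟨l, _, -, hlim⟩ := exists_filter_tendsto_canonicalExtension hz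
  exact tendsto_nhds_unique (hlim _ ((Hinf X).mul_mem hf hg)).2
    ((hlim f hf).2.mul (hlim g hg).2)

theorem canonicalExtension_algebraMap (c : ℂ) (hz : ‖z‖ < 1) :
    canonicalExtension (algebraMap ℂ (UnitBall X →ᵇ ℂ) c) z = c := by
  obtain ⟨l, _, -, hlim⟩ := exists_filter_tendsto_canonicalExtension hz
  refine tendsto_nhds_unique (hlim _ ((Hinf X).algebraMap_mem c)).2
    (tendsto_const_nhds.congr fun x => ?_)
  simp [BoundedContinuousFunction.algebraMap_apply]

theorem canonicalExtension_restrictDual (L : StrongDual ℂ X) (hz : ‖z‖ < 1) :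
    canonicalExtension (restrictDual L) z = z L := by
  obtain ⟨l, _, hdual, hlim⟩ := exists_filter_tendsto_canonicalExtension hz
  exact tendsto_nhds_unique (hlim _ (restrictDual_mem (.inr rfl) L)).2 (hdual L)

theorem norm_canonicalExtension_le {f : UnitBall X →ᵇ ℂ} (hf : IsHolo f) (hz : ‖z‖ < 1) :
    ‖canonicalExtension f z‖ ≤ ‖f‖ := by
  obtain ⟨l, _, -, hlim⟩ := exists_filter_tendsto_canonicalExtension hz
  exact le_of_tendsto (hlim f hf).2.norm (.of_forall f.norm_coe_le_norm)

/-- Schwarz's lemma on the complex line through `z`. -/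
theorem norm_canonicalExtension_le_mul_norm {f : UnitBall X →ᵇ ℂ} (hf : IsHolo f)
    (hf0 : canonicalExtension f (0 : Bidual X) = 0) (hz : ‖z‖ < 1) :
    ‖canonicalExtension f z‖ ≤ ‖f‖ * ‖z‖ := by
  have hlim : Tendsto (fun s : ℝ => ‖f‖ * s) (𝓝[>] ‖z‖) (𝓝 (‖f‖ * ‖z‖)) :=
    ((continuous_const_mul ‖f‖).tendsto ‖z‖).mono_left nhdsWithin_le_nhds
  refine ge_of_tendsto hlim ?_
  filter_upwards [Ioo_mem_nhdsGT hz] with s hs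
  have hs0 : 0 < s := (norm_nonneg z).trans_lt hs.1
  have hball {c : ℂ} (hc : c ∈ Metric.closedBall (0 : ℂ) s⁻¹) : ‖c • z‖ < 1 :=
    norm_smul_lt_one_of_mem_closedBall_inv (x := z) hs.1 hc
  have hdiff : DifferentiableOn ℂ (fun c : ℂ => canonicalExtension f (c • z))
      (Metric.ball 0 s⁻¹) :=
    differentiableOn_canonicalExtension_smul (inv_nonneg.2 hs0.le)
      (summable_taylorExtension hf (hball (by simp [abs_of_pos hs0])))
  have hzero : canonicalExtension f ((0 : ℂ) • z) = 0 := by rwa [zero_smul ℂ z]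
  have hmaps : Set.MapsTo (fun c : ℂ => canonicalExtension f (c • z)) (Metric.ball 0 s⁻¹)
      (Metric.closedBall (canonicalExtension f ((0 : ℂ) • z)) ‖f‖) := fun c hc => by
    rw [hzero, mem_closedBall_zero_iff]
    exact norm_canonicalExtension_le hf (hball (Metric.ball_subset_closedBall hc))
  have h1 : (1 : ℂ) ∈ Metric.ball (0 : ℂ) s⁻¹ := by simpa using (one_lt_inv₀ hs0).2 hs.2
  simpa [hzero] using Complex.dist_le_div_mul_dist_of_mapsTo_ball hdiff hmaps h1

variable {A : Subalgebra ℂ (UnitBall X →ᵇ ℂ)}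

/-- The character `δ_z : f ↦ f̃(z)` of an algebra of bounded holomorphic functions, for `z` in the
open unit ball of the bidual. -/
def bidualEval (hA : A ≤ Hinf X) (z : UnitBall (Bidual X)) : A →ₐ[ℂ] ℂ where
  toFun f := canonicalExtension f.1 z.1
  map_one' := by
    change canonicalExtension (1 : UnitBall X →ᵇ ℂ) z.1 = 1
    rw [← map_one (algebraMap ℂ (UnitBall X →ᵇ ℂ))]
    exact canonicalExtension_algebraMap 1 (norm_coe_unitBall_lt_one z)
  map_mul' f g := canonicalExtension_mul (hA f.2) (hA g.2) (norm_coe_unitBall_lt_one z)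
  map_zero' := by
    change canonicalExtension (0 : UnitBall X →ᵇ ℂ) z.1 = 0
    rw [← map_zero (algebraMap ℂ (UnitBall X →ᵇ ℂ))]
    exact canonicalExtension_algebraMap 0 (norm_coe_unitBall_lt_one z)
  map_add' f g := canonicalExtension_add (hA f.2) (hA g.2) (norm_coe_unitBall_lt_one z)
  commutes' c := by
    change canonicalExtension (algebraMap ℂ (UnitBall X →ᵇ ℂ) c) z.1 = c
    exact canonicalExtension_algebraMap c (norm_coe_unitBall_lt_one z)

theorem rho_bidualEval_zero_le (hA : A ≤ Hinf X) (z : UnitBall (Bidual X)) :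
    rho (bidualEval hA z) (bidualEval hA ⟨0, Metric.mem_ball_self one_pos⟩) ≤ ‖z.1‖ :=
  rho_le fun f hf hf0 =>
    (norm_canonicalExtension_le_mul_norm (hA f.2) hf0 (norm_coe_unitBall_lt_one z)).trans
      (mul_le_of_le_one_left (norm_nonneg z.1) hf)

theorem pseudoHyperbolic_le_rho_of_mem_fiber (hinv : IsInverseClosed A)
    (hX : ∀ L, restrictDual L ∈ A) {z w : Bidual X} {φ ψ : A →ₐ[ℂ] ℂ}
    (hφ : ∀ L, φ ⟨restrictDual L, hX L⟩ = z L) (hψ : ∀ L, ψ ⟨restrictDual L, hX L⟩ = w L)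
    {L : StrongDual ℂ X} (hL : ‖L‖ ≤ 1) (hwL : ‖w L‖ < 1) :
    pseudoHyperbolic (z L) (w L) ≤ rho φ ψ := by
  rw [← hφ, ← hψ]
  exact pseudoHyperbolic_apply_le_rho hinv ((norm_restrictDual_le L).trans hL) (by rwa [hψ])

theorem norm_apply_le_norm_of_norm_le_one {L : StrongDual ℂ X} (hL : ‖L‖ ≤ 1) (w : Bidual X) :
    ‖w L‖ ≤ ‖w‖ :=
  w.le_of_opNorm_le_of_le le_rfl hL |>.trans_eq (mul_one _)

theorem rho_bidualEval_zero (hA : A ≤ Hinf X) (hinv : IsInverseClosed A)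
    (hX : ∀ L, restrictDual L ∈ A) (z : UnitBall (Bidual X)) :
    rho (bidualEval hA ⟨0, Metric.mem_ball_self one_pos⟩) (bidualEval hA z) = ‖z.1‖ := by
  refine le_antisymm ((rho_comm hinv _ _).trans_le (rho_bidualEval_zero_le hA z))
    (le_of_forall_lt fun t ht => ?_)
  obtain ⟨L, hL, htL⟩ := z.1.exists_lt_apply_of_lt_opNorm ht
  have hzL := (norm_apply_le_norm_of_norm_le_one hL.le z.1).trans_lt (norm_coe_unitBall_lt_one z)
  have hfiber (w : UnitBall (Bidual X)) (L : StrongDual ℂ X) :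
      bidualEval hA w ⟨restrictDual L, hX L⟩ = w.1 L :=
    canonicalExtension_restrictDual L (norm_coe_unitBall_lt_one w)
  have hle := pseudoHyperbolic_le_rho_of_mem_fiber hinv hX
    (hfiber ⟨0, Metric.mem_ball_self one_pos⟩) (hfiber z) hL.le hzL
  rw [zero_apply, pseudoHyperbolic_zero_left] at hle
  exact htL.trans_le hle

theorem rho_eq_one_of_mem_fiber (hinv : IsInverseClosed A)
    (hX : ∀ L, restrictDual L ∈ A) {z w : Bidual X} (hz : ‖z‖ = 1) (hw : ‖w‖ < 1)
    {φ ψ : A →ₐ[ℂ] ℂ} (hφ : ∀ L, φ ⟨restrictDual L, hX L⟩ = z L)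
    (hψ : ∀ L, ψ ⟨restrictDual L, hX L⟩ = w L) : rho φ ψ = 1 := by
  have hbound {s : ℝ} (hs : s ∈ Set.Ioo (0 : ℝ) 1) :
      (1 - rho φ ψ ^ 2) * (1 - ‖w‖) ^ 2 ≤ 1 - s ^ 2 := by
    obtain ⟨L, hL, hsL⟩ := z.exists_lt_apply_of_lt_opNorm (hs.2.trans_eq hz.symm)
    have hzL : ‖z L‖ ≤ 1 := hz ▸ norm_apply_le_norm_of_norm_le_one hL.le z
    have hwL : ‖w L‖ ≤ ‖w‖ := norm_apply_le_norm_of_norm_le_one hL.le w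
    have hρ := pseudoHyperbolic_le_rho_of_mem_fiber hinv hX hφ hψ hL.le (hwL.trans_lt hw)
    have hρ1 := rho_le_one hinv φ ψ
    calc (1 - rho φ ψ ^ 2) * (1 - ‖w‖) ^ 2
        ≤ (1 - pseudoHyperbolic (z L) (w L) ^ 2) * ‖1 - conj (w L) * z L‖ ^ 2 := by
          have hp0 : 0 ≤ pseudoHyperbolic (z L) (w L) := norm_nonneg _
          refine mul_le_mul (by gcongr) (pow_le_pow_left₀ (sub_pos.2 hw).le ?_ 2) (sq_nonneg _)
            (sub_nonneg.2 (pow_le_one₀ hp0 (hρ.trans hρ1)))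
          exact (sub_le_sub_left hwL 1).trans (one_sub_norm_le_norm_one_sub_conj_mul hzL)
      _ = (1 - ‖z L‖ ^ 2) * (1 - ‖w L‖ ^ 2) :=
          one_sub_pseudoHyperbolic_sq_mul hzL (hwL.trans_lt hw)
      _ ≤ 1 - ‖z L‖ ^ 2 := mul_le_of_le_one_right (by nlinarith [norm_nonneg (z L)]) (by nlinarith)
      _ ≤ 1 - s ^ 2 := by gcongr; exact hs.1.le
  have hlim : Tendsto (fun s : ℝ => 1 - s ^ 2) (𝓝[<] 1) (𝓝 0) := by
    have hcont : Continuous fun s : ℝ => 1 - s ^ 2 := by fun_prop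
    simpa using (hcont.tendsto 1).mono_left nhdsWithin_le_nhds
  have hle : (1 - rho φ ψ ^ 2) * (1 - ‖w‖) ^ 2 ≤ 0 :=
    ge_of_tendsto hlim (by filter_upwards [Ioo_mem_nhdsLT one_pos] with s hs using hbound hs)
  have hsq : 1 ≤ rho φ ψ ^ 2 :=
    sub_nonpos.1 (nonpos_of_mul_nonpos_left hle (pow_pos (sub_pos.2 hw) 2))
  exact (rho_le_one hinv φ ψ).antisymm ((one_le_sq_iff₀ (rho_nonneg φ ψ)).1 hsq)

end BidualEvaluation

end BallAlgebra

end

open BallAlgebra in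
theorem mainTheorem9_general {X : Type*} [NormedAddCommGroup X] [NormedSpace ℂ X]
    (A : Subalgebra ℂ (UnitBall X →ᵇ ℂ)) (hA : A ≤ Hinf X) (hinv : IsInverseClosed A)
    (hX : ∀ L, restrictDual L ∈ A) :
    (∃ δ : UnitBall (Bidual X) → (A →ₐ[ℂ] ℂ),
      (∀ (z : UnitBall (Bidual X)) (f : A),
        Summable (taylorExtension f.1 z.1) ∧ δ z f = canonicalExtension f.1 z.1) ∧
      (∀ z, δ z ∈ GP (δ ⟨0, Metric.mem_ball_self one_pos⟩)) ∧
      (∀ z, rho (δ ⟨0, Metric.mem_ball_self one_pos⟩) (δ z) = ‖z.1‖)) ∧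
    (∀ z ∈ Metric.sphere (0 : Bidual X) 1,
      ∀ w ∈ Metric.ball (0 : Bidual X) 1,
        ∀ φ : A →ₐ[ℂ] ℂ, (∀ L, φ ⟨restrictDual L, hX L⟩ = z L) →
          ∀ ψ : A →ₐ[ℂ] ℂ, (∀ L, ψ ⟨restrictDual L, hX L⟩ = w L) →
            rho φ ψ = 1 ∧ GP φ ≠ GP ψ) := by
  refine ⟨⟨bidualEval hA, fun z f => ⟨?_, rfl⟩, fun z => ?_,
    rho_bidualEval_zero hA hinv hX⟩, fun z hz w hw φ hφ ψ hψ => ?_⟩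
  · exact summable_taylorExtension (hA f.2) (norm_coe_unitBall_lt_one z)
  · exact (rho_bidualEval_zero hA hinv hX z).trans_lt (norm_coe_unitBall_lt_one z)
  · have hρ : rho φ ψ = 1 :=
      rho_eq_one_of_mem_fiber hinv hX ((mem_sphere_zero_iff_norm (a := z)).1 hz)
        (norm_coe_unitBall_lt_one ⟨w, hw⟩) hφ hψ
    refine ⟨hρ, fun hGP => ?_⟩
    have hψφ : ψ ∈ GP φ := hGP ▸ mem_GP_self ψ
    exact LT.lt.ne hψφ hρ

theorem mainTheorem9 {X : Type*} [NormedAddCommGroup X] [NormedSpace ℂ X] [CompleteSpace X]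
    (A : Subalgebra ℂ (BoundedContinuousFunction (BallAlgebra.UnitBall X) ℂ))
    (hA : A = BallAlgebra.Au X ∨ A = BallAlgebra.Hinf X) :
    (∃ δ : BallAlgebra.UnitBall (BallAlgebra.Bidual X) → (A →ₐ[ℂ] ℂ),
      (∀ (z : BallAlgebra.UnitBall (BallAlgebra.Bidual X)) (f : A),
        Summable (BallAlgebra.taylorExtension f.1 z.1) ∧
          δ z f = BallAlgebra.canonicalExtension f.1 z.1) ∧
      (∀ z, δ z ∈ BallAlgebra.GP (δ ⟨0, Metric.mem_ball_self one_pos⟩)) ∧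
      (∀ z, BallAlgebra.rho (δ ⟨0, Metric.mem_ball_self one_pos⟩) (δ z) = ‖z.1‖)) ∧
    (∀ z ∈ Metric.sphere (0 : BallAlgebra.Bidual X) 1,
      ∀ w ∈ Metric.ball (0 : BallAlgebra.Bidual X) 1,
        ∀ φ ∈ BallAlgebra.fiber hA z, ∀ ψ ∈ BallAlgebra.fiber hA w,
          BallAlgebra.rho φ ψ = 1 ∧ BallAlgebra.GP φ ≠ BallAlgebra.GP ψ) := by
  exact mainTheorem9_general A (BallAlgebra.le_Hinf hA)
    (BallAlgebra.isInverseClosed_of_eq_Au_or_eq_Hinf hA) (BallAlgebra.restrictDual_mem hA)
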